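/- \textbf{Theorem} (functional model, $\tau^2$ unknown). Fix $N\in\mathbb{N}$ and nonrandom real numbers $X_{01},\dots,X_{0N}$ (the observed surrogate regressors). For parameters $\vec\beta=(\beta_0,\beta_1)\in\mathbb{R}^2$ and $\tau^2\ge 0$, consider $N$ independent trials: in the $n$-th trial the unobserved true regressor is $X_n=X_{0n}+U_n$ with $U_n\sim N(0,\tau^2)$ (with $U_n=0$ almost surely if $\tau^2=0$), and the response $Y_n\in\{0,1\}$ satisfies \[ \mathsf{P}(Y_n=1\mid X_n)=\frac{\exp(\beta_0+\beta_1X_n)}{1+\exp(\beta_0+\beta_1X_n)} . \] The couples $(X_{0n},Y_n)$, $n=1,\dots,N$, are observed; let $P_{\vec\beta,\tau^2}$ denote their joint distribution. Suppose that there are at least four distinct values among $X_{01},\dots,X_{0N}$. Then $\vec\beta$ and $\beta_1^2\tau^2$ are identifiable: whenever $P_{\vec\beta^{(1)},(\tau^{(1)})^2}=P_{\vec\beta^{(2)},(\tau^{(2)})^2}$ for two parameter values $(\vec\beta^{(1)},(\tau^{(1)})^2)$ and $(\vec\beta^{(2)},(\tau^{(2)})^2)$, one has $\vec\beta^{(1)}=\vec\beta^{(2)}$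 and $(\beta_1^{(1)})^2(\tau^{(1)})^2=(\beta_1^{(2)})^2(\tau^{(2)})^2$. -/

import Mathlib

open MeasureTheory ProbabilityTheory
open scoped NNReal ENNReal

/-- The logistic function `exp z / (1 + exp z)`. -/
noncomputable def logisticFun (z : ℝ) : ℝ := Real.exp z / (1 + Real.exp z)

theorem logisticFun_nonneg (z : ℝ) : 0 ≤ logisticFun z := by
  unfold logisticFun; positivity

theorem logisticFun_le_one (z : ℝ) : logisticFun z ≤ 1 := by
  unfold logisticFun
  rw [div_le_one (by positivity)]
  linarith

theorem measurable_logisticFun : Measurable logisticFun := by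
  unfold logisticFun; fun_prop

/-- The unknown parameters of the model with unknown error variance: the vector
`β = (β₀, β₁)` of regression coefficients and the error variance `τ² ≥ 0`. -/
structure BerksonParam where
  /-- the regression coefficients `(β₀, β₁)` -/
  β : Fin 2 → ℝ
  /-- the error variance `τ²` -/
  τsq : ℝ≥0

/-- The conditional law of the binary response given that the true regressor equals `x`:
the value `1` has probability `exp (β₀ + β₁ x) / (1 + exp (β₀ + β₁ x))`, and the value `0`
has the complementary probability. -/
noncomputable def responseKernel (β : Fin 2 → ℝ) : Kernel ℝ (Fin 2) where
  toFun x := ENNReal.ofReal (logisticFun (β 0 + β 1 * x)) • Measure.dirac 1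
    + ENNReal.ofReal (1 - logisticFun (β 0 + β 1 * x)) • Measure.dirac 0
  measurable' := by
    have h := measurable_logisticFun
    refine Measure.measurable_of_measurable_coe _ fun s _ => ?_
    simp only [Measure.add_apply, Measure.smul_apply, smul_eq_mul]
    fun_prop

instance (β : Fin 2 → ℝ) : IsMarkovKernel (responseKernel β) where
  isProbabilityMeasure x := ⟨by
    change (ENNReal.ofReal (logisticFun (β 0 + β 1 * x)) • Measure.dirac (1 : Fin 2)
      + ENNReal.ofReal (1 - logisticFun (β 0 + β 1 * x)) • Measure.dirac (0 : Fin 2)) Set.univ = 1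
    simp only [Measure.add_apply, Measure.smul_apply, smul_eq_mul, measure_univ, mul_one]
    rw [← ENNReal.ofReal_add (logisticFun_nonneg _) (sub_nonneg.2 (logisticFun_le_one _))]
    simp⟩

/-- The joint law of the true regressor `X = x₀ + U`, where `U ∼ N(0, τ²)`, and of the
response `Y`, in one trial with (nonrandom) surrogate regressor `x₀`. -/
noncomputable def trialLaw (x₀ : ℝ) (θ : BerksonParam) : Measure (ℝ × Fin 2) :=
  ((gaussianReal 0 θ.τsq).map (fun u => x₀ + u)) ⊗ₘ (responseKernel θ.β)

instance (x₀ : ℝ) (θ : BerksonParam) : IsProbabilityMeasure (trialLaw x₀ θ) := by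
  have : IsProbabilityMeasure ((gaussianReal 0 θ.τsq).map (fun u => x₀ + u)) :=
    Measure.isProbabilityMeasure_map (by fun_prop)
  unfold trialLaw
  infer_instance

/-- The law of the observed couples `(X₀ₙ, Yₙ)`, `n = 1, …, N`, in the functional model: the
`X₀ₙ` are nonrandom, the trials are independent, and the true regressors are not observed. -/
noncomputable def functionalObsLaw {N : ℕ} (X₀ : Fin N → ℝ) (θ : BerksonParam) :
    Measure (Fin N → ℝ × Fin 2) :=
  (Measure.pi fun n => trialLaw (X₀ n) θ).map fun ω n => (X₀ n, (ω n).2)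

/-- The parameter function `g` is identifiable in the statistical model `(P θ)`: its value is
determined by the distribution of the observations. -/
def IsIdentifiable {Θ Ω Γ : Type*} [MeasurableSpace Ω] (P : Θ → Measure Ω) (g : Θ → Γ) : Prop :=
  ∀ θ₁ θ₂ : Θ, P θ₁ = P θ₂ → g θ₁ = g θ₂

/-! In each trial only `P(Y = 1)` is informative. With `σ` the logistic function and `Z` standard
normal, it equals `G(β₀ + β₁ x, s)`, where `G(m, s) = E σ(m + s Z)` and `s = |β₁| τ`. If two
parameters share `s`, then `G(·, s)` is injective, so the two affine functions of `x` agree at two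
points and coincide. It remains to exclude scales `s < t`.

For these, let `T` solve `G(m, s) = G(T m, t)`. Every observed `x` puts a point of one fixed line on
the graph of `T`. The map `T` is odd and strictly concave on `[0, ∞)`
(`strictConcaveOn_logisticTransport`), so a line meets its graph at most three times
(`ncard_lt_four_of_odd_strictConcaveOn`).

For the concavity, put `f = ∂ₘ G`; then `T' = f(m, s) / f(T m, t)`, a ratio of densities at equal
quantiles. The heat equation `∂ₛ G = s ∂ₘ² G` shows that the `s`-derivative of `log f` at a fixed
quantile is `s (log f)''`, so it suffices that `(log f)''` increases in `m > 0`. Writing `f` as a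
Gaussian factor times a Laplace transform makes `(log f)''` an affine function of the variance of an
exponentially tilted density (`logDensityDeriv2_eq`). The derivative of this variance is a third
central moment, and `integral_pow_three_mul_pos` shows that it is positive. -/

open Polynomial in
/-- The derivation of `ℝ[X]` for which `(P ∘ σ)' = (D P) ∘ σ`, `σ` the logistic function. -/
noncomputable def logisticD (P : ℝ[X]) : ℝ[X] := P.derivative * (X - X ^ 2)

/-- The expectation of `P(σ(m + s Z))`, where `v = (m, s)`, `Z` is standard normal and `σ` is the
logistic function. -/
noncomputable def logisticMean (P : Polynomial ℝ) (v : ℝ × ℝ) : ℝ :=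
  ∫ z, P.eval (logisticFun (v.1 + v.2 * z)) ∂gaussianReal 0 1

/-! ### Gaussian averages of the logistic function and the heat equation -/

section Logistic

open Polynomial

theorem logisticFun_eq (x : ℝ) : logisticFun x = 1 - (1 + Real.exp x)⁻¹ := by
  unfold logisticFun
  have := Real.exp_pos x
  field_simp
  ring

theorem logisticFun_pos (x : ℝ) : 0 < logisticFun x := by
  unfold logisticFun; positivity

theorem logisticFun_lt_one (x : ℝ) : logisticFun x < 1 := by
  rw [logisticFun_eq]
  have : 0 < (1 + Real.exp x)⁻¹ := by positivity
  linarith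

theorem logisticFun_neg (x : ℝ) : logisticFun (-x) = 1 - logisticFun x := by
  unfold logisticFun
  rw [Real.exp_neg]
  have := Real.exp_pos x
  field_simp
  ring

theorem hasDerivAt_logisticFun (x : ℝ) :
    HasDerivAt logisticFun (logisticFun x - logisticFun x ^ 2) x := by
  have h : HasDerivAt logisticFun _ x :=
    (Real.hasDerivAt_exp x).div ((Real.hasDerivAt_exp x).const_add 1) (by positivity)
  refine h.congr_deriv ?_
  unfold logisticFun
  have := Real.exp_pos x
  field_simp

theorem strictMono_logisticFun : StrictMono logisticFun := by
  refine strictMono_of_hasDerivAt_pos hasDerivAt_logisticFun fun x => ?_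
  nlinarith [logisticFun_pos x, logisticFun_lt_one x]

theorem continuous_logisticFun : Continuous logisticFun :=
  continuous_iff_continuousAt.2 fun x => (hasDerivAt_logisticFun x).continuousAt

theorem tendsto_logisticFun_atTop : Filter.Tendsto logisticFun Filter.atTop (nhds 1) := by
  have h : Filter.Tendsto (fun x => 1 - (1 + Real.exp x)⁻¹) Filter.atTop (nhds (1 - 0)) :=
    tendsto_const_nhds.sub (tendsto_inv_atTop_zero.comp
      (Filter.tendsto_atTop_add_const_left _ _ Real.tendsto_exp_atTop))
  simpa [funext logisticFun_eq] using h

theorem hasDerivAt_eval_logisticFun (P : ℝ[X]) (x : ℝ) :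
    HasDerivAt (fun x => P.eval (logisticFun x)) ((logisticD P).eval (logisticFun x)) x := by
  have h : HasDerivAt (fun x => P.eval (logisticFun x)) _ x :=
    (P.hasDerivAt (logisticFun x)).comp x (hasDerivAt_logisticFun x)
  exact h.congr_deriv (by simp [logisticD])

theorem continuous_eval_logisticFun (P : ℝ[X]) : Continuous fun x => P.eval (logisticFun x) :=
  P.continuous.comp continuous_logisticFun

theorem exists_abs_eval_logisticFun_le (P : ℝ[X]) : ∃ C, ∀ x, |P.eval (logisticFun x)| ≤ C := by
  obtain ⟨C, hC⟩ := (isCompact_Icc (a := (0 : ℝ)) (b := 1)).exists_bound_of_continuousOn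
    P.continuous.continuousOn
  exact ⟨C, fun x => hC _ ⟨logisticFun_nonneg x, logisticFun_le_one x⟩⟩

theorem eval_logisticD_X (x : ℝ) :
    (logisticD X).eval (logisticFun x) = logisticFun x * (1 - logisticFun x) := by
  simp [logisticD]; ring

theorem integrable_eval_logisticFun {μ : Measure ℝ} [IsFiniteMeasure μ] (P : ℝ[X]) (m s : ℝ) :
    Integrable (fun z => P.eval (logisticFun (m + s * z))) μ := by
  obtain ⟨C, hC⟩ := exists_abs_eval_logisticFun_le P
  refine Integrable.of_bound ?_ C (ae_of_all _ fun z => hC _)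
  exact ((continuous_eval_logisticFun P).comp (by fun_prop)).aestronglyMeasurable

theorem integrable_id_gaussianReal (m : ℝ) (v : ℝ≥0) : Integrable (fun x => x) (gaussianReal m v) :=
  (memLp_id_gaussianReal (μ := m) (v := v) 1).integrable (by simp)

theorem integrable_mul_eval_logisticFun (P : ℝ[X]) (m s : ℝ) :
    Integrable (fun z => z * P.eval (logisticFun (m + s * z))) (gaussianReal 0 1) := by
  obtain ⟨C, hC⟩ := exists_abs_eval_logisticFun_le P
  refine (integrable_id_gaussianReal 0 1).mul_bdd (c := C) ?_ (ae_of_all _ fun z => hC _)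
  exact ((continuous_eval_logisticFun P).comp (by fun_prop)).aestronglyMeasurable

theorem hasDerivAt_gaussianPDFReal (x : ℝ) :
    HasDerivAt (gaussianPDFReal 0 1) (-(x * gaussianPDFReal 0 1 x)) x := by
  unfold gaussianPDFReal
  have h : HasDerivAt (fun x : ℝ => -(x - 0) ^ 2 / (2 * ((1 : ℝ≥0) : ℝ))) (-x) x := by
    have h : HasDerivAt (fun x : ℝ => -(x - 0) ^ 2 / (2 * ((1 : ℝ≥0) : ℝ))) _ x :=
      (((hasDerivAt_id x).sub_const 0).pow 2).neg.div_const (2 * ((1 : ℝ≥0) : ℝ))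
    exact h.congr_deriv (by simp; ring)
  exact (h.exp.const_mul (√(2 * Real.pi * ((1 : ℝ≥0) : ℝ)))⁻¹).congr_deriv (by ring)

theorem integrable_gaussianReal_iff {f : ℝ → ℝ} :
    Integrable f (gaussianReal 0 1) ↔ Integrable (fun x => gaussianPDFReal 0 1 x * f x) := by
  rw [gaussianReal_of_var_ne_zero _ one_ne_zero, integrable_withDensity_iff_integrable_smul'
    (measurable_gaussianPDF _ _) (ae_of_all _ fun _ => gaussianPDF_lt_top)]
  simp [toReal_gaussianPDF]

/-- Gaussian integration by parts. -/
theorem integral_mul_eval_logisticFun (P : ℝ[X]) (m s : ℝ) :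
    ∫ z, z * P.eval (logisticFun (m + s * z)) ∂gaussianReal 0 1 =
      s * logisticMean (logisticD P) (m, s) := by
  have hu : ∀ z, HasDerivAt (fun z => P.eval (logisticFun (m + s * z)))
      (s * (logisticD P).eval (logisticFun (m + s * z))) z := fun z => by
    have h1 : HasDerivAt (fun z => m + s * z) s z := by
      simpa using ((hasDerivAt_id z).const_mul s).const_add m
    have h := (hasDerivAt_eval_logisticFun P (m + s * z)).comp z h1
    exact h.congr_deriv (mul_comm _ _)
  -- The Gaussian density satisfies `φ' = -z φ`, so the factor `z` is absorbed into `φ'`.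
  have key := integral_mul_deriv_eq_deriv_mul_of_integrable
    (u := fun z => P.eval (logisticFun (m + s * z))) (v := gaussianPDFReal 0 1)
    (fun z _ => hu z) (fun z _ => hasDerivAt_gaussianPDFReal z) ?_ ?_ ?_
  · rw [logisticMean, integral_gaussianReal_eq_integral_smul one_ne_zero,
      integral_gaussianReal_eq_integral_smul one_ne_zero, ← integral_const_mul]
    simp only [smul_eq_mul]
    rw [← neg_inj, ← integral_neg]
    calc _ = _ := integral_congr_ae (ae_of_all _ fun z => by ring)
      _ = _ := key
      _ = _ := congrArg Neg.neg (integral_congr_ae (ae_of_all _ fun z => by ring))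
  · refine (integrable_gaussianReal_iff.1 (integrable_mul_eval_logisticFun P m s)).neg.congr
      (ae_of_all _ fun z => ?_)
    simp; ring
  · refine (integrable_gaussianReal_iff.1 ((integrable_eval_logisticFun
      (logisticD P) m s).const_mul s)).congr (ae_of_all _ fun z => ?_)
    simp; ring
  · refine (integrable_gaussianReal_iff.1 (integrable_eval_logisticFun P m s)).congr
      (ae_of_all _ fun z => ?_)
    simp; ring

/-- Heat equation: differentiating in `s` under the integral produces a factor `z`, which Gaussian
integration by parts trades for `s` and one more derivative in `m`. Nothing degenerates at `s = 0`.
-/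
theorem hasFDerivAt_logisticMean (P : ℝ[X]) (v : ℝ × ℝ) :
    HasFDerivAt (logisticMean P)
      (logisticMean (logisticD P) v • ContinuousLinearMap.fst ℝ ℝ ℝ +
        (v.2 * logisticMean (logisticD (logisticD P)) v) • ContinuousLinearMap.snd ℝ ℝ ℝ) v := by
  obtain ⟨C, hC⟩ := exists_abs_eval_logisticFun_le (logisticD P)
  let F' : ℝ × ℝ → ℝ → (ℝ × ℝ →L[ℝ] ℝ) := fun v z =>
    ((logisticD P).eval (logisticFun (v.1 + v.2 * z))) • ContinuousLinearMap.fst ℝ ℝ ℝ +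
    (z * (logisticD P).eval (logisticFun (v.1 + v.2 * z))) • ContinuousLinearMap.snd ℝ ℝ ℝ
  have hi1 := (integrable_eval_logisticFun (μ := gaussianReal 0 1)
    (logisticD P) v.1 v.2).smul_const (ContinuousLinearMap.fst ℝ ℝ ℝ)
  have hi2 := (integrable_mul_eval_logisticFun
    (logisticD P) v.1 v.2).smul_const (ContinuousLinearMap.snd ℝ ℝ ℝ)
  have key := hasFDerivAt_integral_of_dominated_of_fderiv_le (μ := gaussianReal 0 1)
    (F := fun (v : ℝ × ℝ) z => P.eval (logisticFun (v.1 + v.2 * z))) (F' := F') (x₀ := v)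
    (s := Set.univ) (bound := fun z => C + |z| * C) Filter.univ_mem
    (Filter.Eventually.of_forall fun v =>
      (integrable_eval_logisticFun P v.1 v.2).aestronglyMeasurable)
    (integrable_eval_logisticFun P v.1 v.2) (hi1.add hi2).aestronglyMeasurable ?_ ?_ ?_
  · have e : ∫ z, F' v z ∂gaussianReal 0 1 =
        logisticMean (logisticD P) v • ContinuousLinearMap.fst ℝ ℝ ℝ +
        (v.2 * logisticMean (logisticD (logisticD P)) v) • ContinuousLinearMap.snd ℝ ℝ ℝ := by
      rw [integral_add hi1 hi2, integral_smul_const, integral_smul_const,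
        integral_mul_eval_logisticFun]
      rfl
    rw [e] at key
    exact key
  · refine ae_of_all _ fun z v _ => (norm_add_le _ _).trans (add_le_add ?_ ?_)
    · rw [norm_smul, ← mul_one C]
      exact mul_le_mul (hC _) (ContinuousLinearMap.norm_fst_le ℝ ℝ ℝ) (norm_nonneg _)
        ((abs_nonneg _).trans (hC 0))
    · rw [norm_smul, norm_mul, ← mul_one (|z| * C)]
      exact mul_le_mul (mul_le_mul_of_nonneg_left (hC _) (abs_nonneg _))
        (ContinuousLinearMap.norm_snd_le ℝ ℝ ℝ) (norm_nonneg _)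
        (mul_nonneg (abs_nonneg _) ((abs_nonneg _).trans (hC 0)))
  · exact (integrable_const _).add ((integrable_id_gaussianReal 0 1).abs.mul_const C)
  · refine ae_of_all _ fun z v _ => ?_
    have h1 : HasFDerivAt (fun v : ℝ × ℝ => v.1 + v.2 * z)
        (ContinuousLinearMap.fst ℝ ℝ ℝ + z • ContinuousLinearMap.snd ℝ ℝ ℝ) v := by
      refine hasFDerivAt_fst.add ?_
      exact hasFDerivAt_snd.mul_const z
    refine ((hasDerivAt_eval_logisticFun P _).comp_hasFDerivAt v h1).congr_fderiv ?_
    ext <;> simp [F']; ring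

theorem continuous_logisticMean (P : ℝ[X]) : Continuous (logisticMean P) :=
  continuous_iff_continuousAt.2 fun v => (hasFDerivAt_logisticMean P v).continuousAt

theorem hasDerivAt_logisticMean (P : ℝ[X]) (m s : ℝ) :
    HasDerivAt (fun m => logisticMean P (m, s)) (logisticMean (logisticD P) (m, s)) m := by
  have h : HasDerivAt (fun m : ℝ => (m, s)) (1, 0) m :=
    (hasDerivAt_id m).prodMk (hasDerivAt_const m s)
  have h' := (hasFDerivAt_logisticMean P (m, s)).comp_hasDerivAt m h
  exact h'.congr_deriv (by simp)

theorem logisticMean_deriv_pos (v : ℝ × ℝ) : 0 < logisticMean (logisticD X) v := by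
  refine (integral_pos_iff_support_of_nonneg (fun z => ?_)
    (integrable_eval_logisticFun _ v.1 v.2)).2 ?_
  · rw [Pi.zero_apply, eval_logisticD_X]
    nlinarith [logisticFun_pos (v.1 + v.2 * z), logisticFun_lt_one (v.1 + v.2 * z)]
  · have : Function.support (fun z => (logisticD X).eval (logisticFun (v.1 + v.2 * z))) =
        Set.univ := by
      ext z
      simp only [Function.mem_support, eval_logisticD_X, Set.mem_univ, iff_true]
      nlinarith [logisticFun_pos (v.1 + v.2 * z), logisticFun_lt_one (v.1 + v.2 * z)]
    rw [this]
    simp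

theorem strictMono_logisticMean (s : ℝ) : StrictMono fun m => logisticMean X (m, s) :=
  strictMono_of_hasDerivAt_pos (fun m => hasDerivAt_logisticMean X m s)
    fun _ => logisticMean_deriv_pos _

/-- Symmetry of `Z` combined with `σ(-x) = 1 - σ(x)`. It places the median at `0` for every scale
and later makes the transport map odd. -/
theorem logisticMean_neg (m s : ℝ) : logisticMean X (-m, s) = 1 - logisticMean X (m, s) := by
  have h : logisticMean X (-m, s) = ∫ z, (1 - logisticFun (m + s * z)) ∂gaussianReal 0 1 := by
    have h1 : (gaussianReal 0 1).map (fun x : ℝ => -x) = gaussianReal 0 1 := by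
      simpa using gaussianReal_map_neg (μ := 0) (v := 1)
    have h2 : Continuous fun z => (X : ℝ[X]).eval (logisticFun (-m + s * z)) :=
      (continuous_eval_logisticFun X).comp (by fun_prop)
    have h3 := integral_map (μ := gaussianReal 0 1) (φ := fun x : ℝ => -x) (by fun_prop)
      h2.aestronglyMeasurable
    rw [h1] at h3
    refine h3.trans ?_
    refine integral_congr_ae (ae_of_all _ fun z => ?_)
    simp only [eval_X, ← logisticFun_neg]
    congr 1
    ring
  rw [h, integral_sub (integrable_const _)
    (by simpa using integrable_eval_logisticFun (μ := gaussianReal 0 1) X m s)]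
  simp [logisticMean]

theorem logisticMean_zero (s : ℝ) : logisticMean X (0, s) = 1 / 2 := by
  have := logisticMean_neg 0 s
  simp only [neg_zero] at this
  linarith

theorem tendsto_logisticMean_atTop (s : ℝ) :
    Filter.Tendsto (fun m => logisticMean X (m, s)) Filter.atTop (nhds 1) := by
  have h := tendsto_integral_filter_of_dominated_convergence (μ := gaussianReal 0 1)
    (l := Filter.atTop) (F := fun m z => (X : ℝ[X]).eval (logisticFun (m + s * z)))
    (f := fun _ => (1 : ℝ)) (fun _ => (1 : ℝ))
    (Filter.Eventually.of_forall fun m =>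
      (integrable_eval_logisticFun X m s).aestronglyMeasurable)
    (Filter.Eventually.of_forall fun m => ae_of_all _ fun z => by
      simpa [abs_of_nonneg (logisticFun_nonneg _)] using logisticFun_le_one _)
    (integrable_const _)
    (ae_of_all _ fun z => by
      simp only [eval_X]
      exact tendsto_logisticFun_atTop.comp
        (Filter.tendsto_atTop_add_const_right _ (s * z) Filter.tendsto_id))
  simpa [logisticMean] using h

theorem logisticMean_lt_one (m s : ℝ) : logisticMean X (m, s) < 1 :=
  (strictMono_logisticMean s (lt_add_one m)).trans_le
    ((strictMono_logisticMean s).monotone.ge_of_tendsto (tendsto_logisticMean_atTop s) _)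

theorem logisticMean_pos (m s : ℝ) : 0 < logisticMean X (m, s) := by
  have := logisticMean_lt_one (-m) s
  rw [logisticMean_neg] at this
  linarith

theorem exists_logisticMean_eq {p : ℝ} (hp : p ∈ Set.Ioo (0 : ℝ) 1) (s : ℝ) :
    ∃ m, logisticMean X (m, s) = p := by
  obtain ⟨b, hb⟩ := ((tendsto_logisticMean_atTop s).eventually (lt_mem_nhds hp.2)).exists
  obtain ⟨a, ha⟩ := ((tendsto_logisticMean_atTop s).eventually
    (lt_mem_nhds (show 1 - p < 1 by linarith [hp.1]))).exists
  have hc : Continuous fun m => logisticMean X (m, s) :=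
    (continuous_logisticMean X).comp (by fun_prop)
  refine mem_range_of_exists_le_of_exists_ge hc ⟨-a, ?_⟩ ⟨b, hb.le⟩
  rw [logisticMean_neg]
  linarith

end Logistic

/-! ### Sign of the third moment of a skewed density -/

theorem integral_odd_mul {p : ℝ → ℝ} {g : ℝ → ℝ} (hg : ∀ y, g (-y) = -g y)
    (hi : Integrable fun y => g y * p y) :
    (Integrable fun y => g y * (p y - p (-y))) ∧
      ∫ y, g y * (p y - p (-y)) = 2 * ∫ y, g y * p y := by
  have e : (fun y => g y * (p y - p (-y))) = fun y => g y * p y + g (-y) * p (-y) := by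
    funext y
    rw [hg]
    ring
  rw [e]
  have hi' : Integrable fun y => g (-y) * p (-y) := hi.comp_neg
  refine ⟨hi.add hi', ?_⟩
  rw [integral_add hi hi', integral_neg_eq_self (fun y => g y * p y)]
  ring

theorem integral_id_mul_pos {p : ℝ → ℝ} (hp : Continuous p) (hi : Integrable fun y => y * p y)
    (h : ∀ y, 0 < y → p (-y) < p y) : 0 < ∫ y, y * p y := by
  obtain ⟨h1, h2⟩ := integral_odd_mul (g := fun y => y) (fun _ => rfl) hi
  have h3 : 0 < ∫ y, y * (p y - p (-y)) := by
    refine integral_pos_of_integrable_nonneg_nonzero (x := 1) (by fun_prop) h1 (fun y => ?_) ?_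
    · rcases lt_trichotomy y 0 with hy | rfl | hy
      · have := h (-y) (by linarith)
        rw [neg_neg] at this
        exact (mul_pos_of_neg_of_neg hy (by linarith)).le
      · simp
      · exact (mul_pos hy (by linarith [h y hy])).le
    · have := h 1 one_pos
      simp only [one_mul]
      linarith
  linarith

/-- A centred density `p` such that `log (p y / p (-y))` is strictly convex on `[0, ∞)` has
positive third moment. -/
theorem integral_pow_three_mul_pos {p : ℝ → ℝ} (hp : Continuous p) (hpos : ∀ y, 0 < p y)
    (hi1 : Integrable fun y => y * p y) (hi3 : Integrable fun y => y ^ 3 * p y)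
    (hmean : ∫ y, y * p y = 0)
    (hD : StrictConvexOn ℝ (Set.Ici 0) fun y => Real.log (p y) - Real.log (p (-y))) :
    0 < ∫ y, y ^ 3 * p y := by
  set D : ℝ → ℝ := fun y => Real.log (p y) - Real.log (p (-y)) with hDdef
  have hD0 : D 0 = 0 := by simp [hDdef]
  have hDc : Continuous D :=
    (hp.log fun y => (hpos y).ne').sub ((hp.comp continuous_neg).log fun y => (hpos _).ne')
  have hlt : ∀ {y}, 0 < D y → p (-y) < p y := fun {y} h =>
    (Real.log_lt_log_iff (hpos _) (hpos _)).1 (by simpa [hDdef] using h)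
  have hgt : ∀ {y}, D y < 0 → p y < p (-y) := fun {y} h =>
    (Real.log_lt_log_iff (hpos _) (hpos _)).1 (by simpa [hDdef] using h)
  -- Without a positive zero, `D` keeps one sign on `(0, ∞)`, and the mean could not vanish.
  obtain ⟨c, hc, hDc0⟩ : ∃ c, 0 < c ∧ D c = 0 := by
    by_contra! hne
    have hsign : (∀ y, 0 < y → 0 < D y) ∨ (∀ y, 0 < y → D y < 0) := by
      by_contra! hcon
      obtain ⟨⟨a, ha, hDa⟩, b, hb, hDb⟩ := hcon
      obtain ⟨c, hc, hc0⟩ := isPreconnected_Ioi.intermediate_value (show a ∈ Set.Ioi (0 : ℝ) from ha)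
        (show b ∈ Set.Ioi (0 : ℝ) from hb) hDc.continuousOn ⟨hDa, hDb⟩
      exact hne c hc hc0
    rcases hsign with h | h
    · exact (integral_id_mul_pos hp hi1 fun y hy => hlt (h y hy)).ne' hmean
    · have := integral_id_mul_pos (p := fun y => p (-y)) (by fun_prop)
        (by simpa using hi1.comp_neg.neg) fun y hy => by simpa using hgt (h y hy)
      have e := integral_neg_eq_self (fun y => y * p y) volume
      simp only [neg_mul, integral_neg] at e
      linarith
  -- A strictly convex function with zeros at `0` and `c` is negative between them and positive
  -- beyond `c`.
  have hD_neg : ∀ y, 0 < y → y < c → D y < 0 := fun y hy hyc => by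
    have := hD.2 (Set.mem_Ici.2 hc.le) (Set.mem_Ici.2 le_rfl) hc.ne' (div_pos hy hc)
      (sub_pos.2 ((div_lt_one hc).2 hyc)) (by ring)
    simpa [hDc0, hD0, div_mul_cancel₀ _ hc.ne'] using this
  have hD_pos : ∀ y, c < y → 0 < D y := fun y hcy => by
    have hy := hc.trans hcy
    have := hD.2 (Set.mem_Ici.2 hy.le) (Set.mem_Ici.2 le_rfl) hy.ne' (div_pos hc hy)
      (sub_pos.2 ((div_lt_one hy).2 hcy)) (by ring)
    simp only [smul_eq_mul, div_mul_cancel₀ _ hy.ne', mul_zero, add_zero, hDc0, hD0] at this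
    exact pos_of_mul_pos_right this (div_pos hc hy).le
  -- Subtracting `c² y` leaves the third moment unchanged because the mean is zero, and makes the
  -- cubic change sign exactly where `p y - p (-y)` does.
  have hnn : ∀ y, 0 ≤ y → 0 ≤ (y ^ 3 - c ^ 2 * y) * (p y - p (-y)) := fun y hy => by
    have e : y ^ 3 - c ^ 2 * y = y * (y + c) * (y - c) := by ring
    rw [e, mul_assoc]
    refine mul_nonneg (by positivity) ?_
    rcases hy.eq_or_lt with rfl | hy
    · simp
    rcases lt_trichotomy y c with h | rfl | h
    · exact (mul_pos_of_neg_of_neg (by linarith) (by linarith [hgt (hD_neg y hy h)])).le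
    · simp
    · exact (mul_pos (by linarith) (by linarith [hlt (hD_pos y h)])).le
  have hig : Integrable fun y => (y ^ 3 - c ^ 2 * y) * p y := by
    refine (hi3.sub (hi1.const_mul (c ^ 2))).congr (ae_of_all _ fun y => ?_)
    simp only [Pi.sub_apply]
    ring
  obtain ⟨h1, h2⟩ := integral_odd_mul (g := fun y => y ^ 3 - c ^ 2 * y) (fun _ => by ring) hig
  have h3 : 0 < ∫ y, (y ^ 3 - c ^ 2 * y) * (p y - p (-y)) := by
    refine integral_pos_of_integrable_nonneg_nonzero (x := 2 * c) (by fun_prop) h1 (fun y => ?_) ?_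
    · rcases le_total 0 y with hy | hy
      · exact hnn y hy
      · have := hnn (-y) (by linarith)
        rw [neg_neg] at this
        refine this.trans_eq (by ring)
    · refine mul_ne_zero ?_ (sub_ne_zero.2 (hlt (hD_pos _ (by linarith))).ne')
      have e : (2 * c) ^ 3 - c ^ 2 * (2 * c) = 6 * c ^ 3 := by ring
      rw [e]
      positivity
  have h4 : ∫ y, (y ^ 3 - c ^ 2 * y) * p y = ∫ y, y ^ 3 * p y := by
    have : ∀ y, (y ^ 3 - c ^ 2 * y) * p y = y ^ 3 * p y - c ^ 2 * (y * p y) := fun y => by ring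
    simp only [this]
    rw [integral_sub hi3 (hi1.const_mul _), integral_const_mul, hmean]
    ring
  linarith

/-! ### Exponential tilts of the logistic density times a Gaussian -/

/-- The logistic density `σ (1 - σ)`. -/
noncomputable def logisticDensity (x : ℝ) : ℝ := logisticFun x * (1 - logisticFun x)

theorem logisticDensity_pos (x : ℝ) : 0 < logisticDensity x :=
  mul_pos (logisticFun_pos x) (sub_pos.2 (logisticFun_lt_one x))

theorem logisticDensity_le_one (x : ℝ) : logisticDensity x ≤ 1 := by
  unfold logisticDensity
  nlinarith [logisticFun_pos x, logisticFun_lt_one x]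

theorem continuous_logisticDensity : Continuous logisticDensity :=
  continuous_logisticFun.mul (continuous_const.sub continuous_logisticFun)

theorem logisticDensity_neg (x : ℝ) : logisticDensity (-x) = logisticDensity x := by
  unfold logisticDensity
  rw [logisticFun_neg]
  ring

theorem logisticDensity_lt {a b : ℝ} (h1 : -a < b) (h2 : b < a) :
    logisticDensity a < logisticDensity b := by
  have h3 := strictMono_logisticFun h1
  have h4 := strictMono_logisticFun h2
  rw [logisticFun_neg] at h3
  unfold logisticDensity
  nlinarith

theorem hasDerivAt_log_logisticDensity (x : ℝ) :
    HasDerivAt (fun x => Real.log (logisticDensity x)) (1 - 2 * logisticFun x) x := by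
  have h1 := hasDerivAt_logisticFun x
  have h2 := (h1.mul (h1.const_sub 1)).log (logisticDensity_pos x).ne'
  refine h2.congr_deriv ?_
  have := logisticFun_pos x
  have := sub_pos.2 (logisticFun_lt_one x)
  simp only [Pi.mul_apply]
  field_simp
  ring

/-- The sum of a linear function and of the log-ratio of the logistic density at points symmetric
about `μ > 0` is strictly convex. -/
theorem strictConvexOn_log_logisticDensity_sub {μ : ℝ} (hμ : 0 < μ) (c : ℝ) :
    StrictConvexOn ℝ (Set.Ici 0) fun y =>
      Real.log (logisticDensity (μ + y)) - Real.log (logisticDensity (μ - y)) + c * y := by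
  have hd : ∀ y, HasDerivAt (fun y =>
      Real.log (logisticDensity (μ + y)) - Real.log (logisticDensity (μ - y)) + c * y)
      (2 - 2 * (logisticFun (μ + y) + logisticFun (μ - y)) + c) y := fun y => by
    have h1 := (hasDerivAt_log_logisticDensity (μ + y)).comp y ((hasDerivAt_id y).const_add μ)
    have h2 := (hasDerivAt_log_logisticDensity (μ - y)).comp y ((hasDerivAt_id y).const_sub μ)
    exact ((h1.sub h2).add ((hasDerivAt_id y).const_mul c)).congr_deriv (by ring)
  have hs : StrictAntiOn (fun y => logisticFun (μ + y) + logisticFun (μ - y)) (Set.Ioi 0) := by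
    have hd' : ∀ y, HasDerivAt (fun y => logisticFun (μ + y) + logisticFun (μ - y))
        (logisticDensity (μ + y) - logisticDensity (μ - y)) y := fun y => by
      have h1 := (hasDerivAt_logisticFun (μ + y)).comp y ((hasDerivAt_id y).const_add μ)
      have h2 := (hasDerivAt_logisticFun (μ - y)).comp y ((hasDerivAt_id y).const_sub μ)
      exact (h1.add h2).congr_deriv (by unfold logisticDensity; ring)
    refine strictAntiOn_of_deriv_neg (convex_Ioi 0)
      (fun y _ => (hd' y).continuousAt.continuousWithinAt) fun y hy => ?_
    rw [interior_Ioi, Set.mem_Ioi] at hy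
    rw [(hd' y).deriv, sub_neg]
    -- The density decreases in `|x|`, and `|μ - y| < μ + y` when both `μ` and `y` are positive.
    exact logisticDensity_lt (by linarith) (by linarith)
  refine StrictMonoOn.strictConvexOn_of_deriv (convex_Ici 0)
    (fun y _ => (hd y).continuousAt.continuousWithinAt) ?_
  rw [interior_Ici]
  intro a ha b hb hab
  rw [(hd a).deriv, (hd b).deriv]
  have := hs ha hb hab
  simp only at this
  linarith

/-- The measure with density `σ (1 - σ)` with respect to `N(0, t)`. -/
noncomputable def logisticGaussian (t : ℝ≥0) : Measure ℝ :=
  (gaussianReal 0 t).withDensity fun y => ENNReal.ofReal (logisticDensity y)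

/-- The moments of the exponentially tilted measure `logisticGaussian t`. -/
noncomputable def tiltedMoment (t : ℝ≥0) (k : ℕ) (θ : ℝ) : ℝ :=
  ∫ y, y ^ k * Real.exp (θ * y) ∂logisticGaussian t

/-- The Lebesgue density of the exponentially tilted measure `logisticGaussian t`. -/
noncomputable def tiltedDensity (t : ℝ≥0) (θ y : ℝ) : ℝ :=
  logisticDensity y * gaussianPDFReal 0 t y * Real.exp (θ * y)

theorem logisticGaussian_le (t : ℝ≥0) : logisticGaussian t ≤ gaussianReal 0 t := by
  unfold logisticGaussian
  conv_rhs => rw [← withDensity_one (μ := gaussianReal 0 t)]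
  exact withDensity_mono (ae_of_all _ fun y =>
    ENNReal.ofReal_le_one.2 (logisticDensity_le_one y))

theorem integrableExpSet_logisticGaussian (t : ℝ≥0) :
    integrableExpSet id (logisticGaussian t) = Set.univ := by
  ext θ
  simp only [Set.mem_univ, iff_true]
  exact (integrable_exp_mul_gaussianReal θ).mono_measure (logisticGaussian_le t)

theorem hasDerivAt_tiltedMoment (t : ℝ≥0) (k : ℕ) (θ : ℝ) :
    HasDerivAt (tiltedMoment t k) (tiltedMoment t (k + 1) θ) θ :=
  hasDerivAt_integral_pow_mul_exp_real (X := id) (μ := logisticGaussian t)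
    (by rw [integrableExpSet_logisticGaussian]; simp) k

theorem logisticGaussian_eq {t : ℝ≥0} (ht : t ≠ 0) : logisticGaussian t =
    volume.withDensity fun y => ENNReal.ofReal (logisticDensity y * gaussianPDFReal 0 t y) := by
  rw [logisticGaussian, gaussianReal_of_var_ne_zero _ ht, ← withDensity_mul _
    (measurable_gaussianPDF _ _) continuous_logisticDensity.measurable.ennreal_ofReal]
  congr 1
  funext y
  rw [Pi.mul_apply, mul_comm, ENNReal.ofReal_mul (logisticDensity_pos y).le]
  rfl

theorem continuous_gaussianPDFReal (m : ℝ) (t : ℝ≥0) : Continuous (gaussianPDFReal m t) := by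
  unfold gaussianPDFReal
  fun_prop

theorem tiltedMoment_eq {t : ℝ≥0} (ht : t ≠ 0) (k : ℕ) (θ : ℝ) :
    tiltedMoment t k θ = ∫ y, y ^ k * tiltedDensity t θ y := by
  have hm : Measurable fun y => ENNReal.ofReal (logisticDensity y * gaussianPDFReal 0 t y) :=
    (continuous_logisticDensity.mul (continuous_gaussianPDFReal 0 t)).measurable.ennreal_ofReal
  rw [tiltedMoment, logisticGaussian_eq ht, integral_withDensity_eq_integral_toReal_smul hm
    (ae_of_all _ fun _ => ENNReal.ofReal_lt_top)]
  refine integral_congr_ae (ae_of_all _ fun y => ?_)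
  simp only [smul_eq_mul, tiltedDensity]
  rw [ENNReal.toReal_ofReal (mul_nonneg (logisticDensity_pos y).le (gaussianPDFReal_nonneg _ _ _))]
  ring

theorem integrable_pow_mul_tiltedDensity {t : ℝ≥0} (ht : t ≠ 0) (k : ℕ) (θ : ℝ) :
    Integrable fun y => y ^ k * tiltedDensity t θ y := by
  have hm : Measurable fun y => ENNReal.ofReal (logisticDensity y * gaussianPDFReal 0 t y) :=
    (continuous_logisticDensity.mul (continuous_gaussianPDFReal 0 t)).measurable.ennreal_ofReal
  have h := integrable_pow_mul_exp_of_mem_interior_integrableExpSet (X := id)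
    (μ := logisticGaussian t) (v := θ) (by rw [integrableExpSet_logisticGaussian]; simp) k
  rw [logisticGaussian_eq ht, integrable_withDensity_iff_integrable_smul' hm
    (ae_of_all _ fun _ => ENNReal.ofReal_lt_top)] at h
  refine h.congr (ae_of_all _ fun y => ?_)
  simp only [smul_eq_mul, tiltedDensity, id]
  rw [ENNReal.toReal_ofReal (mul_nonneg (logisticDensity_pos y).le (gaussianPDFReal_nonneg _ _ _))]
  ring

theorem tiltedDensity_pos {t : ℝ≥0} (ht : t ≠ 0) (θ y : ℝ) : 0 < tiltedDensity t θ y :=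
  mul_pos (mul_pos (logisticDensity_pos y) (gaussianPDFReal_pos _ _ _ ht)) (Real.exp_pos _)

theorem continuous_tiltedDensity (t : ℝ≥0) (θ : ℝ) : Continuous (tiltedDensity t θ) :=
  (continuous_logisticDensity.mul (continuous_gaussianPDFReal 0 t)).mul (by fun_prop)

theorem tiltedMoment_zero_pos {t : ℝ≥0} (ht : t ≠ 0) (θ : ℝ) : 0 < tiltedMoment t 0 θ := by
  rw [tiltedMoment_eq ht]
  have hi := integrable_pow_mul_tiltedDensity ht 0 θ
  simp only [pow_zero, one_mul] at hi ⊢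
  exact integral_pos_of_integrable_nonneg_nonzero (x := 0) (continuous_tiltedDensity t θ) hi
    (fun y => (tiltedDensity_pos ht θ y).le) (tiltedDensity_pos ht θ 0).ne'

/-- The untilted density is even, so for `θ > 0` the factor `exp (θ y)` favours `y` over `-y`. The
resulting positive mean is the centre `μ > 0` that the convexity of the log-ratio needs. -/
theorem tiltedMoment_one_pos {t : ℝ≥0} (ht : t ≠ 0) {θ : ℝ} (hθ : 0 < θ) :
    0 < tiltedMoment t 1 θ := by
  rw [tiltedMoment_eq ht]
  have hi := integrable_pow_mul_tiltedDensity ht 1 θ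
  simp only [pow_one] at hi ⊢
  refine integral_id_mul_pos (continuous_tiltedDensity t θ) hi fun y hy => ?_
  unfold tiltedDensity
  have e : gaussianPDFReal 0 t (-y) = gaussianPDFReal 0 t y := by simp [gaussianPDFReal]
  rw [logisticDensity_neg, e]
  refine mul_lt_mul_of_pos_left (Real.exp_lt_exp.2 ?_)
    (mul_pos (logisticDensity_pos y) (gaussianPDFReal_pos _ _ _ ht))
  nlinarith

theorem log_tiltedDensity {t : ℝ≥0} (ht : t ≠ 0) (θ y : ℝ) : Real.log (tiltedDensity t θ y) =
    Real.log (logisticDensity y) + Real.log (√(2 * Real.pi * t))⁻¹ - y ^ 2 / (2 * t) + θ * y := by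
  have ht' : (0 : ℝ) < t := NNReal.coe_pos.2 (pos_iff_ne_zero.2 ht)
  have h1 := (logisticDensity_pos y).ne'
  have h2 : (√(2 * Real.pi * t))⁻¹ ≠ 0 := by positivity
  rw [tiltedDensity, Real.log_mul (mul_pos (logisticDensity_pos y)
    (gaussianPDFReal_pos _ _ _ ht)).ne' (Real.exp_pos _).ne', Real.log_mul h1
    (gaussianPDFReal_pos _ _ _ ht).ne', gaussianPDFReal, Real.log_mul h2 (Real.exp_pos _).ne',
    Real.log_exp, Real.log_exp]
  ring

/-- The variance of the normalised tilted measure. -/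
noncomputable def tiltedVariance (t : ℝ≥0) (θ : ℝ) : ℝ :=
  tiltedMoment t 2 θ / tiltedMoment t 0 θ - (tiltedMoment t 1 θ / tiltedMoment t 0 θ) ^ 2

theorem integral_centered_pow_three_pos {t : ℝ≥0} (ht : t ≠ 0) {θ : ℝ} (hθ : 0 < θ) :
    0 < ∫ y, y ^ 3 *
      tiltedDensity t θ (tiltedMoment t 1 θ / tiltedMoment t 0 θ + y) := by
  have h0 := tiltedMoment_zero_pos ht θ
  have h1 := tiltedMoment_one_pos ht hθ
  set μ := tiltedMoment t 1 θ / tiltedMoment t 0 θ with hμdef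
  have hμ : 0 < μ := div_pos h1 h0
  have hi : ∀ k, Integrable fun y => y ^ k * tiltedDensity t θ y :=
    fun k => integrable_pow_mul_tiltedDensity ht k θ
  have i1 : Integrable fun y => (y - μ) * tiltedDensity t θ y := by
    refine ((hi 1).sub ((hi 0).const_mul μ)).congr (ae_of_all _ fun y => ?_)
    simp only [Pi.sub_apply]
    ring
  have i3 : Integrable fun y => (y - μ) ^ 3 * tiltedDensity t θ y := by
    refine ((((hi 3).sub ((hi 2).const_mul (3 * μ))).add ((hi 1).const_mul (3 * μ ^ 2))).sub
      ((hi 0).const_mul (μ ^ 3))).congr (ae_of_all _ fun y => ?_)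
    simp only [Pi.sub_apply, Pi.add_apply]
    ring
  refine integral_pow_three_mul_pos ((continuous_tiltedDensity t θ).comp (by fun_prop))
    (fun y => tiltedDensity_pos ht θ _) ?_ ?_ ?_ ?_
  · simpa using i1.comp_add_left μ
  · simpa using i3.comp_add_left μ
  · have := integral_add_left_eq_self (μ := volume) (fun y => (y - μ) * tiltedDensity t θ y) μ
    simp only [add_sub_cancel_left] at this
    rw [this]
    have e : ∀ y, (y - μ) * tiltedDensity t θ y =
      y ^ 1 * tiltedDensity t θ y - μ * (y ^ 0 * tiltedDensity t θ y) := fun y => by ring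
    simp only [e]
    rw [integral_sub (hi 1) ((hi 0).const_mul μ), integral_const_mul, ← tiltedMoment_eq ht,
      ← tiltedMoment_eq ht, hμdef]
    field_simp
    ring
  -- In the log-ratio at `μ ± y` the tilt contributes `2 θ y` and the Gaussian factor `-2 μ y / t`.
  -- Both are linear, so only the logistic factor affects convexity.
  · have hs := strictConvexOn_log_logisticDensity_sub hμ (2 * θ - 2 * μ / t)
    have ht' : (t : ℝ) ≠ 0 := NNReal.coe_ne_zero.2 ht
    convert hs using 2 with y
    rw [log_tiltedDensity ht, log_tiltedDensity ht, ← sub_eq_add_neg]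
    field_simp
    ring

/-- In an exponential family the derivative of the second cumulant is the third, which is the third
central moment. -/
theorem tiltedVariance_strictMonoOn {t : ℝ≥0} (ht : t ≠ 0) :
    StrictMonoOn (tiltedVariance t) (Set.Ioi 0) := by
  have hi : ∀ θ k, Integrable fun y => y ^ k * tiltedDensity t θ y :=
    fun θ k => integrable_pow_mul_tiltedDensity ht k θ
  have hd : ∀ θ, HasDerivAt (tiltedVariance t) ((tiltedMoment t 0 θ)⁻¹ * ∫ y, y ^ 3 *
      tiltedDensity t θ (tiltedMoment t 1 θ / tiltedMoment t 0 θ + y)) θ := fun θ => by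
    have h0 := (tiltedMoment_zero_pos ht θ).ne'
    have d0 := hasDerivAt_tiltedMoment t 0 θ
    have d1 := hasDerivAt_tiltedMoment t 1 θ
    have d2 := hasDerivAt_tiltedMoment t 2 θ
    refine ((d2.div d0 h0).sub ((d1.div d0 h0).pow 2)).congr_deriv ?_
    set μ := tiltedMoment t 1 θ / tiltedMoment t 0 θ with hμdef
    have := integral_add_left_eq_self (μ := volume) (fun y => (y - μ) ^ 3 * tiltedDensity t θ y) μ
    simp only [add_sub_cancel_left] at this
    rw [this]
    have e : ∀ y, (y - μ) ^ 3 * tiltedDensity t θ y =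
      y ^ 3 * tiltedDensity t θ y - 3 * μ * (y ^ 2 * tiltedDensity t θ y) +
      3 * μ ^ 2 * (y ^ 1 * tiltedDensity t θ y) - μ ^ 3 * (y ^ 0 * tiltedDensity t θ y) :=
      fun y => by ring
    simp only [e]
    have j1 : Integrable fun y => y ^ 3 * tiltedDensity t θ y -
        3 * μ * (y ^ 2 * tiltedDensity t θ y) := (hi θ 3).sub ((hi θ 2).const_mul _)
    have j2 : Integrable fun y => y ^ 3 * tiltedDensity t θ y -
        3 * μ * (y ^ 2 * tiltedDensity t θ y) + 3 * μ ^ 2 * (y ^ 1 * tiltedDensity t θ y) :=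
      j1.add ((hi θ 1).const_mul _)
    rw [integral_sub j2 ((hi θ 0).const_mul _), integral_add j1 ((hi θ 1).const_mul _),
      integral_sub (hi θ 3) ((hi θ 2).const_mul _), integral_const_mul, integral_const_mul,
      integral_const_mul, ← tiltedMoment_eq ht, ← tiltedMoment_eq ht, ← tiltedMoment_eq ht,
      ← tiltedMoment_eq ht, hμdef]
    simp only [Pi.div_apply, Nat.add_one_sub_one, pow_one, zero_add, Nat.reduceAdd]
    field_simp
    ring
  refine strictMonoOn_of_deriv_pos (convex_Ioi 0)
    (fun θ _ => (hd θ).continuousAt.continuousWithinAt) fun θ hθ => ?_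
  rw [interior_Ioi] at hθ
  rw [(hd θ).deriv]
  exact mul_pos (inv_pos.2 (tiltedMoment_zero_pos ht θ)) (integral_centered_pow_three_pos ht hθ)

/-! ### The smoothed density as a Laplace transform -/

open Polynomial in
theorem logisticMean_deriv_eq {t : ℝ≥0} (ht : t ≠ 0) (m : ℝ) :
    logisticMean (logisticD X) (m, √t) =
      Real.exp (-m ^ 2 / (2 * t)) * tiltedMoment t 0 (m / t) := by
  have ht' : (t : ℝ) ≠ 0 := NNReal.coe_ne_zero.2 ht
  have hmap : (gaussianReal 0 1).map (fun z => m + √t * z) = gaussianReal m t := by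
    have h1 := gaussianReal_map_const_mul (μ := 0) (v := 1) √t
    have h2 := gaussianReal_map_const_add (μ := 0) (v := t) m
    have e : (NNReal.mk (√(t : ℝ) ^ 2) (sq_nonneg _)) = t := by
      ext
      simp
    rw [mul_zero, mul_one, e] at h1
    rw [← h1, Measure.map_map (by fun_prop) (by fun_prop)] at h2
    simpa [Function.comp_def, h1] using h2
  have h3 := integral_map (μ := gaussianReal 0 1) (φ := fun z => m + √t * z) (by fun_prop)
    (continuous_eval_logisticFun (logisticD X)).aestronglyMeasurable
  rw [hmap, integral_gaussianReal_eq_integral_smul ht] at h3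
  rw [logisticMean, ← h3, tiltedMoment_eq ht, ← integral_const_mul]
  refine integral_congr_ae (ae_of_all _ fun y => ?_)
  simp only [smul_eq_mul, eval_logisticD_X, tiltedDensity, gaussianPDFReal, logisticDensity]
  have e : Real.exp (-(y - m) ^ 2 / (2 * t)) =
      Real.exp (-m ^ 2 / (2 * t)) * (Real.exp (-(y - 0) ^ 2 / (2 * t)) * Real.exp (m / t * y)) := by
    rw [← Real.exp_add, ← Real.exp_add]
    congr 1
    field_simp
    ring
  rw [e]
  ring

open Polynomial in
/-- The second derivative in `m` of `log ∂ₘ E σ(m + s Z)`. -/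
noncomputable def logDensityDeriv2 (v : ℝ × ℝ) : ℝ :=
  logisticMean (logisticD (logisticD (logisticD X))) v / logisticMean (logisticD X) v -
    (logisticMean (logisticD (logisticD X)) v / logisticMean (logisticD X) v) ^ 2

-- Taking logarithms of the Laplace representation, the Gaussian factor contributes `-1 / t`. The
-- second derivative of the cumulant generating function is the tilted variance, and the argument `m
-- / t` supplies the factor `1 / t²`.
open Polynomial in
theorem logDensityDeriv2_eq {t : ℝ≥0} (ht : t ≠ 0) (m : ℝ) :
    logDensityDeriv2 (m, √t) = -1 / t + tiltedVariance t (m / t) / t ^ 2 := by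
  have ht' : (t : ℝ) ≠ 0 := NNReal.coe_ne_zero.2 ht
  have hM : ∀ k m, HasDerivAt (fun m : ℝ => tiltedMoment t k (m / t))
      (tiltedMoment t (k + 1) (m / t) / t) m := fun k m => by
    have h := (hasDerivAt_tiltedMoment t k (m / t)).comp m ((hasDerivAt_id m).div_const (t : ℝ))
    exact h.congr_deriv (by ring)
  have hE : ∀ m : ℝ, HasDerivAt (fun m : ℝ => Real.exp (-m ^ 2 / (2 * t)))
      (Real.exp (-m ^ 2 / (2 * t)) * (-m / t)) m := fun m => by
    have h := (((hasDerivAt_id m).pow 2).neg.div_const (2 * (t : ℝ))).exp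
    exact h.congr_deriv (by simp; field_simp)
  have h1 : ∀ m, logisticMean (logisticD (logisticD X)) (m, √t) = Real.exp (-m ^ 2 / (2 * t)) *
      (tiltedMoment t 1 (m / t) / t - m / t * tiltedMoment t 0 (m / t)) := fun m => by
    have h := hasDerivAt_logisticMean (logisticD X) m √t
    simp only [logisticMean_deriv_eq ht] at h
    refine h.unique (((hE m).mul (hM 0 m)).congr_deriv (by ring))
  have h2 : logisticMean (logisticD (logisticD (logisticD X))) (m, √t) =
      Real.exp (-m ^ 2 / (2 * t)) * (tiltedMoment t 2 (m / t) / t ^ 2 -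
        2 * (m / t) * tiltedMoment t 1 (m / t) / t +
        ((m / t) ^ 2 - 1 / t) * tiltedMoment t 0 (m / t)) := by
    have h := hasDerivAt_logisticMean (logisticD (logisticD X)) m √t
    simp only [h1] at h
    refine h.unique (((hE m).mul (((hM 1 m).div_const (t : ℝ)).sub
      (((hasDerivAt_id m).div_const (t : ℝ)).mul (hM 0 m)))).congr_deriv ?_)
    simp only [Pi.sub_apply, Pi.mul_apply, id]
    field_simp
    ring
  have h0 := (tiltedMoment_zero_pos ht (m / t)).ne'
  have hexp := (Real.exp_pos (-m ^ 2 / (2 * t))).ne'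
  rw [logDensityDeriv2, h2, h1, logisticMean_deriv_eq ht, tiltedVariance,
    mul_div_mul_left _ _ hexp, mul_div_mul_left _ _ hexp]
  field_simp
  ring

theorem logDensityDeriv2_strictMonoOn {s : ℝ} (hs : 0 < s) :
    StrictMonoOn (fun m => logDensityDeriv2 (m, s)) (Set.Ioi 0) := by
  obtain ⟨t, ht, rfl⟩ : ∃ t : ℝ≥0, t ≠ 0 ∧ s = √t :=
    ⟨⟨s ^ 2, sq_nonneg s⟩, NNReal.coe_ne_zero.1 (pow_pos hs 2).ne', (Real.sqrt_sq hs.le).symm⟩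
  have ht' : (0 : ℝ) < t := NNReal.coe_pos.2 (pos_iff_ne_zero.2 ht)
  intro a ha b hb hab
  simp only [logDensityDeriv2_eq ht]
  have := tiltedVariance_strictMonoOn ht (show a / t ∈ Set.Ioi (0 : ℝ) from div_pos ha ht')
    (show b / t ∈ Set.Ioi (0 : ℝ) from div_pos hb ht') (by gcongr)
  gcongr

/-! ### Quantiles and the transport between two scales -/

section Quantile

open Polynomial

/-- For `v = (p, s)`, the solution `m` of `E σ(m + s Z) = p`. -/
noncomputable def logisticQuantile (v : ℝ × ℝ) : ℝ :=
  Function.invFun (fun m => logisticMean X (m, v.2)) v.1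

theorem logisticMean_quantile {p : ℝ} (hp : p ∈ Set.Ioo (0 : ℝ) 1) (s : ℝ) :
    logisticMean X (logisticQuantile (p, s), s) = p :=
  Function.invFun_eq (f := fun m => logisticMean X (m, s)) (exists_logisticMean_eq hp s)

theorem logisticQuantile_mean (m s : ℝ) : logisticQuantile (logisticMean X (m, s), s) = m :=
  Function.leftInverse_invFun (strictMono_logisticMean s).injective m

theorem logisticMean_mem_Ioo (m s : ℝ) : logisticMean X (m, s) ∈ Set.Ioo (0 : ℝ) 1 :=
  ⟨logisticMean_pos m s, logisticMean_lt_one m s⟩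

theorem logisticQuantile_lt {p q : ℝ} (hp : p ∈ Set.Ioo (0 : ℝ) 1) (hq : q ∈ Set.Ioo (0 : ℝ) 1)
    (hpq : p < q) (s : ℝ) : logisticQuantile (p, s) < logisticQuantile (q, s) := by
  refine (strictMono_logisticMean s).lt_iff_lt.1 ?_
  simpa only [logisticMean_quantile hp, logisticMean_quantile hq] using hpq

theorem logisticQuantile_pos {p : ℝ} (hp : 1 / 2 < p) (hp1 : p < 1) (s : ℝ) :
    0 < logisticQuantile (p, s) := by
  have hp' : p ∈ Set.Ioo (0 : ℝ) 1 := ⟨by linarith, hp1⟩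
  refine (strictMono_logisticMean s).lt_iff_lt.1 ?_
  simpa only [logisticMean_quantile hp', logisticMean_zero] using hp

/-- Joint continuity is the input needed to differentiate the local inverse. Monotonicity in `m`
turns bounds on the quantile into strict inequalities between continuous functions, which are open
conditions. -/
theorem continuousAt_logisticQuantile {p : ℝ} (hp : p ∈ Set.Ioo (0 : ℝ) 1) (s : ℝ) :
    ContinuousAt logisticQuantile (p, s) := by
  have hev : ∀ᶠ v : ℝ × ℝ in nhds (p, s), v.1 ∈ Set.Ioo (0 : ℝ) 1 :=
    continuous_fst.continuousAt.eventually (isOpen_Ioo.mem_nhds hp)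
  have hc : ∀ m, Continuous fun v : ℝ × ℝ => logisticMean X (m, v.2) := fun m =>
    (continuous_logisticMean X).comp (by fun_prop)
  refine tendsto_order.2 ⟨fun a ha => ?_, fun b hb => ?_⟩
  · have h : logisticMean X (a, s) < p := by
      simpa only [logisticMean_quantile hp] using strictMono_logisticMean s ha
    filter_upwards [hev, (hc a).continuousAt.eventually_lt continuous_fst.continuousAt h]
      with v hv hlt
    refine (strictMono_logisticMean v.2).lt_iff_lt.1 ?_
    simpa only [logisticMean_quantile hv] using hlt
  · have h : p < logisticMean X (b, s) := by
      simpa only [logisticMean_quantile hp] using strictMono_logisticMean s hb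
    filter_upwards [hev, continuous_fst.continuousAt.eventually_lt (hc b).continuousAt h]
      with v hv hlt
    refine (strictMono_logisticMean v.2).lt_iff_lt.1 ?_
    simpa only [logisticMean_quantile hv] using hlt

/-- The linear automorphism `(x, y) ↦ (a x + b y, y)` of the plane. -/
noncomputable def shearEquiv (a b : ℝ) (ha : a ≠ 0) : (ℝ × ℝ) ≃L[ℝ] ℝ × ℝ :=
  ContinuousLinearEquiv.equivOfInverse
    ((a • ContinuousLinearMap.fst ℝ ℝ ℝ + b • ContinuousLinearMap.snd ℝ ℝ ℝ).prod
      (ContinuousLinearMap.snd ℝ ℝ ℝ))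
    ((a⁻¹ • (ContinuousLinearMap.fst ℝ ℝ ℝ - b • ContinuousLinearMap.snd ℝ ℝ ℝ)).prod
      (ContinuousLinearMap.snd ℝ ℝ ℝ))
    (fun v => by ext <;> simp [ha])
    (fun v => by ext <;> simp [ha])

/-- The map `(p, s) ↦ (quantile, s)` inverts `(m, s) ↦ (G(m, s), s)`, whose derivative is a shear
with nonzero diagonal entry `∂ₘ G`. -/
theorem hasFDerivAt_logisticQuantile {p : ℝ} (hp : p ∈ Set.Ioo (0 : ℝ) 1) (s : ℝ) :
    HasFDerivAt logisticQuantile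
      ((logisticMean (logisticD X) (logisticQuantile (p, s), s))⁻¹ •
        (ContinuousLinearMap.fst ℝ ℝ ℝ -
          (s * logisticMean (logisticD (logisticD X)) (logisticQuantile (p, s), s)) •
            ContinuousLinearMap.snd ℝ ℝ ℝ)) (p, s) := by
  have ha := (logisticMean_deriv_pos (logisticQuantile (p, s), s)).ne'
  have hT : HasFDerivAt (fun v : ℝ × ℝ => (logisticMean X v, v.2))
      (shearEquiv _ (s * logisticMean (logisticD (logisticD X)) (logisticQuantile (p, s), s))
        ha : ℝ × ℝ →L[ℝ] ℝ × ℝ) (logisticQuantile (p, s), s) :=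
    (hasFDerivAt_logisticMean X _).prodMk hasFDerivAt_snd
  have hg : HasFDerivAt (fun v : ℝ × ℝ => (logisticQuantile v, v.2)) _ (p, s) :=
    HasFDerivAt.of_local_left_inverse (f := fun v : ℝ × ℝ => (logisticMean X v, v.2))
      ((continuousAt_logisticQuantile hp s).prodMk continuousAt_snd) hT ?_
  · exact hasFDerivAt_fst.comp (p, s) hg
  · filter_upwards [continuous_fst.continuousAt.eventually (isOpen_Ioo.mem_nhds hp)] with v hv
    exact Prod.ext (logisticMean_quantile hv v.2) rfl

theorem hasDerivAt_logisticQuantile_right {p : ℝ} (hp : p ∈ Set.Ioo (0 : ℝ) 1) (s : ℝ) :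
    HasDerivAt (fun s => logisticQuantile (p, s))
      (-(s * logisticMean (logisticD (logisticD X)) (logisticQuantile (p, s), s)) /
        logisticMean (logisticD X) (logisticQuantile (p, s), s)) s := by
  have h := (hasFDerivAt_logisticQuantile hp s).comp_hasDerivAt s
    ((hasDerivAt_const s p).prodMk (hasDerivAt_id s))
  exact h.congr_deriv (by simp; ring)

/-- The logarithmic derivative, in the scale `s`, of the density at the `p`-quantile. -/
theorem hasDerivAt_log_density_quantile {p : ℝ} (hp : p ∈ Set.Ioo (0 : ℝ) 1) (s : ℝ) :
    HasDerivAt (fun s => Real.log (logisticMean (logisticD X) (logisticQuantile (p, s), s)))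
      (s * logDensityDeriv2 (logisticQuantile (p, s), s)) s := by
  have hpos := (logisticMean_deriv_pos (logisticQuantile (p, s), s)).ne'
  have h := (hasFDerivAt_logisticMean (logisticD X) (logisticQuantile (p, s), s)).comp_hasDerivAt
    (f := fun s => (logisticQuantile (p, s), s))
    s ((hasDerivAt_logisticQuantile_right hp s).prodMk (hasDerivAt_id s))
  refine (h.log hpos).congr_deriv ?_
  simp only [add_apply, smul_apply,
    ContinuousLinearMap.coe_fst', ContinuousLinearMap.coe_snd', smul_eq_mul, Function.comp_apply,
    logDensityDeriv2, mul_one]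
  field_simp
  ring

/-- The log-density at the `q`-quantile minus that at the `p`-quantile has `r`-derivative `r` times
a difference of values of `(log f)''`. This is positive since both quantiles lie right of the median
`0`, where `(log f)''` increases. -/
theorem density_quantile_ratio_lt {p q s t : ℝ} (hp : 1 / 2 < p) (hpq : p < q) (hq : q < 1)
    (hs : 0 ≤ s) (hst : s < t) :
    logisticMean (logisticD X) (logisticQuantile (q, s), s) /
        logisticMean (logisticD X) (logisticQuantile (q, t), t) <
      logisticMean (logisticD X) (logisticQuantile (p, s), s) /
        logisticMean (logisticD X) (logisticQuantile (p, t), t) := by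
  have hp' : p ∈ Set.Ioo (0 : ℝ) 1 := ⟨by linarith, hpq.trans hq⟩
  have hq' : q ∈ Set.Ioo (0 : ℝ) 1 := ⟨by linarith, hq⟩
  have hd := fun r => (hasDerivAt_log_density_quantile hq' r).sub
    (hasDerivAt_log_density_quantile hp' r)
  have hmono : StrictMonoOn _ (Set.Icc s t) := strictMonoOn_of_deriv_pos (convex_Icc s t)
    (fun r _ => (hd r).continuousAt.continuousWithinAt) fun r hr => by
      rw [interior_Icc] at hr
      -- Only interior scales matter, so `s = 0` (no measurement error) is covered.
      have hr0 : 0 < r := hs.trans_lt hr.1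
      rw [(hd r).deriv, ← mul_sub]
      refine mul_pos hr0 (sub_pos.2 ?_)
      exact logDensityDeriv2_strictMonoOn hr0 (logisticQuantile_pos hp (hpq.trans hq) r)
        (logisticQuantile_pos (hp.trans hpq) hq r) (logisticQuantile_lt hp' hq' hpq r)
  have h := hmono ⟨le_rfl, hst.le⟩ ⟨hst.le, le_rfl⟩ hst
  simp only [Pi.sub_apply] at h
  have f := fun v => logisticMean_deriv_pos v
  rw [← Real.log_lt_log_iff (div_pos (f _) (f _)) (div_pos (f _) (f _)),
    Real.log_div (f _).ne' (f _).ne', Real.log_div (f _).ne' (f _).ne']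
  linarith

/-- The map `m ↦ m'` defined by `E σ(m + s Z) = E σ(m' + t Z)`. -/
noncomputable def logisticTransport (s t m : ℝ) : ℝ :=
  logisticQuantile (logisticMean X (m, s), t)

theorem logisticMean_transport (s t m : ℝ) :
    logisticMean X (logisticTransport s t m, t) = logisticMean X (m, s) :=
  logisticMean_quantile (logisticMean_mem_Ioo m s) t

theorem logisticTransport_eq {s t m m' : ℝ} (h : logisticMean X (m, s) = logisticMean X (m', t)) :
    logisticTransport s t m = m' := by
  rw [logisticTransport, h, logisticQuantile_mean]

theorem logisticTransport_neg (s t m : ℝ) :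
    logisticTransport s t (-m) = -logisticTransport s t m := by
  refine logisticTransport_eq ?_
  rw [logisticMean_neg, logisticMean_neg, logisticMean_transport]

theorem hasDerivAt_logisticTransport (s t m : ℝ) : HasDerivAt (logisticTransport s t)
    (logisticMean (logisticD X) (m, s) /
      logisticMean (logisticD X) (logisticTransport s t m, t)) m := by
  have h := (hasFDerivAt_logisticQuantile (logisticMean_mem_Ioo m s) t).comp_hasDerivAt m
    ((hasDerivAt_logisticMean X m s).prodMk (hasDerivAt_const m t))
  refine h.congr_deriv ?_
  simp only [sub_apply, smul_apply,
    ContinuousLinearMap.coe_fst', ContinuousLinearMap.coe_snd', smul_eq_mul, mul_zero, sub_zero]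
  rw [logisticTransport, inv_mul_eq_div]

/-- The derivative of the transport is the ratio of the two densities at a common quantile level,
and this ratio decreases as the level rises above `1 / 2`. -/
theorem strictConcaveOn_logisticTransport {s t : ℝ} (hs : 0 ≤ s) (hst : s < t) :
    StrictConcaveOn ℝ (Set.Ici 0) (logisticTransport s t) := by
  refine StrictAntiOn.strictConcaveOn_of_deriv (convex_Ici 0)
    (fun m _ => (hasDerivAt_logisticTransport s t m).continuousAt.continuousWithinAt) ?_
  rw [interior_Ici]
  intro a ha b _ hab
  rw [(hasDerivAt_logisticTransport s t a).deriv, (hasDerivAt_logisticTransport s t b).deriv]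
  have h := density_quantile_ratio_lt (p := logisticMean X (a, s)) (q := logisticMean X (b, s))
    (by rw [← logisticMean_zero s]; exact strictMono_logisticMean s ha)
    (strictMono_logisticMean s hab) (logisticMean_lt_one b s) hs hst
  rwa [logisticQuantile_mean, logisticQuantile_mean] at h

end Quantile

/-! ### Counting intersections with a line -/

theorem StrictConcaveOn.not_three_collinear {S : Set ℝ} {f : ℝ → ℝ} (hf : StrictConcaveOn ℝ S f)
    {c d x y z : ℝ} (hx : x ∈ S) (hz : z ∈ S) (hxy : x < y) (hyz : y < z)
    (ex : f x = c + d * x) (ey : f y = c + d * y) (ez : f z = c + d * z) : False := by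
  have h := hf.slope_anti_adjacent hx hz hxy hyz
  rw [ex, ey, ez, div_lt_div_iff₀ (by linarith) (by linarith)] at h
  linarith

/-- A line meets the graph of an odd function that is strictly concave on `[0, ∞)` in at most
three points. -/
theorem ncard_lt_four_of_odd_strictConcaveOn {f : ℝ → ℝ} (hodd : ∀ x, f (-x) = -f x)
    (hf : StrictConcaveOn ℝ (Set.Ici 0) f) {S : Set ℝ} {c d : ℝ}
    (hS : ∀ x ∈ S, f x = c + d * x) : S.ncard < 4 := by
  -- Reflection through the origin preserves the graph and changes the sign of the intercept.
  wlog hc : 0 ≤ c generalizing S c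
  · have h := this (S := Neg.neg '' S) (c := -c) (by
      rintro _ ⟨x, hx, rfl⟩
      rw [hodd, hS x hx]
      ring) (by linarith)
    rwa [Set.ncard_image_of_injective _ neg_injective] at h
  have hf0 : f 0 = 0 := by
    have := hodd 0
    rw [neg_zero] at this
    linarith
  -- Reflected to the right half-line, two such points lie on the line with intercept `-c ≤ 0`. The
  -- chord from the origin to the nearer one then has slope at most `d`, while the next chord has
  -- slope exactly `d`, against strict concavity.
  have h1 : (S ∩ Set.Iio 0).ncard ≤ 1 := by
    have key : ∀ x y, x ∈ S → y < 0 → y ∈ S → x < y → False := fun x y hx hy0 hy hxy => by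
      have h := hf.slope_anti_adjacent (x := 0) (y := -y) (z := -x) (Set.mem_Ici.2 le_rfl)
        (Set.mem_Ici.2 (by linarith)) (by linarith) (by linarith)
      rw [hodd, hodd, hS x hx, hS y hy, hf0, div_lt_div_iff₀ (by linarith) (by linarith)] at h
      nlinarith
    by_contra! h
    obtain ⟨a, b, ha, hb, hab⟩ := (Set.one_lt_ncard_iff
      (Set.finite_of_ncard_pos (by omega))).1 h
    rcases lt_or_gt_of_ne hab with h' | h'
    · exact key a b ha.1 hb.2 hb.1 h'
    · exact key b a hb.1 ha.2 ha.1 h'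
  have h2 : (S ∩ Set.Ici 0).ncard ≤ 2 := by
    have key : ∀ x y z, x ∈ S ∩ Set.Ici 0 → y ∈ S ∩ Set.Ici 0 → z ∈ S ∩ Set.Ici 0 →
        x < y → y < z → False := fun x y z hx hy hz hxy hyz =>
      hf.not_three_collinear hx.2 hz.2 hxy hyz (hS x hx.1) (hS y hy.1) (hS z hz.1)
    by_contra! h
    obtain ⟨a, b, e, ha, hb, he, hab, hae, hbe⟩ := (Set.two_lt_ncard_iff
      (Set.finite_of_ncard_pos (by omega))).1 h
    rcases lt_or_gt_of_ne hab with h1 | h1 <;> rcases lt_or_gt_of_ne hae with h2 | h2 <;>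
      rcases lt_or_gt_of_ne hbe with h3 | h3
    · exact key a b e ha hb he h1 h3
    · exact key a e b ha he hb h2 h3
    · linarith
    · exact key e a b he ha hb h2 h1
    · exact key b a e hb ha he h1 h2
    · linarith
    · exact key b e a hb he ha h3 h2
    · exact key e b a he hb ha h3 h1
  have h3 : S = S ∩ Set.Iio 0 ∪ S ∩ Set.Ici 0 := by
    rw [← Set.inter_union_distrib_left, Set.Iio_union_Ici, Set.inter_univ]
  have h4 := Set.ncard_union_le (S ∩ Set.Iio 0) (S ∩ Set.Ici 0)
  rw [← h3] at h4
  omega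

open Polynomial in
/-- Two curves `x ↦ E σ(a + b x + s Z)` with different scales meet in at most three points. -/
theorem ncard_lt_four_of_logisticMean_eq {S : Set ℝ} {a b a' b' s s' : ℝ} (hs : 0 ≤ s)
    (hss' : s < s') (hb' : b' ≠ 0)
    (h : ∀ x ∈ S, logisticMean X (a + b * x, s) = logisticMean X (a' + b' * x, s')) :
    S.ncard < 4 := by
  -- When `b = 0` the left side is constant while the right side is injective in `x`, so at most one
  -- point is possible.
  by_cases hb : b = 0
  · by_contra! hcard
    obtain ⟨x, y, hx, hy, hxy⟩ := (Set.one_lt_ncard_iff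
      (Set.finite_of_ncard_pos (by omega))).1 (show 1 < S.ncard by omega)
    have h1 := h x hx
    have h2 := h y hy
    rw [hb, zero_mul] at h1 h2
    have h3 := (strictMono_logisticMean s').injective (h1.symm.trans h2)
    exact hxy (mul_left_cancel₀ hb' (add_left_cancel h3))
  · have hinj : Function.Injective fun x => a + b * x := fun x y hxy =>
      mul_left_cancel₀ hb (add_left_cancel hxy)
    rw [← Set.ncard_image_of_injective S hinj]
    -- The line arises by eliminating `x` from `m = a + b x` and `m' = a' + b' x`.
    refine ncard_lt_four_of_odd_strictConcaveOn (logisticTransport_neg s s')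
      (strictConcaveOn_logisticTransport hs hss') (c := a' - b' / b * a) (d := b' / b) ?_
    rintro _ ⟨x, hx, rfl⟩
    rw [logisticTransport_eq (h x hx)]
    field_simp
    ring

/-! ### From the law of the observations to the parameters -/

theorem integral_logisticFun_gaussianReal (a b : ℝ) (t : ℝ≥0) :
    ∫ u, logisticFun (a + b * u) ∂gaussianReal 0 t =
      logisticMean Polynomial.X (a, |b| * √t) := by
  have h1 := gaussianReal_map_const_mul (μ := 0) (v := t) b
  have h2 := gaussianReal_map_const_mul (μ := 0) (v := 1) (|b| * √t)
  have e : (NNReal.mk (b ^ 2) (sq_nonneg _)) * t =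
      (NNReal.mk ((|b| * √t) ^ 2) (sq_nonneg _)) * 1 := by
    ext
    simp [mul_pow]
  rw [mul_zero, e] at h1
  rw [mul_zero] at h2
  have hc : Continuous fun w => logisticFun (a + w) := continuous_logisticFun.comp (by fun_prop)
  have h3 := integral_map (μ := gaussianReal 0 t) (φ := fun u => b * u) (by fun_prop)
    hc.aestronglyMeasurable
  have h4 := integral_map (μ := gaussianReal 0 1) (φ := fun u => |b| * √t * u) (by fun_prop)
    hc.aestronglyMeasurable
  rw [h1, ← h2, h4] at h3
  simp [logisticMean, h3]

theorem functionalObsLaw_response {N : ℕ} (X₀ : Fin N → ℝ) (θ : BerksonParam) (n : Fin N) :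
    functionalObsLaw X₀ θ {ω | (ω n).2 = 1} = ENNReal.ofReal
      (logisticMean Polynomial.X (θ.β 0 + θ.β 1 * X₀ n, |θ.β 1| * √θ.τsq)) := by
  have hm : MeasurableSet {ω : Fin N → ℝ × Fin 2 | (ω n).2 = 1} :=
    (measurable_snd.comp (measurable_pi_apply n)) (measurableSet_singleton 1)
  have hm' : MeasurableSet {p : ℝ × Fin 2 | p.2 = 1} := measurable_snd (measurableSet_singleton 1)
  have hmap : Measurable fun (ω : Fin N → ℝ × Fin 2) n => (X₀ n, (ω n).2) := by fun_prop
  rw [functionalObsLaw, Measure.map_apply hmap hm]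
  have h1 := (measurePreserving_eval (fun n => trialLaw (X₀ n) θ) n).measure_preimage
    hm'.nullMeasurableSet
  refine Eq.trans h1 ?_
  have : IsProbabilityMeasure ((gaussianReal 0 θ.τsq).map (fun u => X₀ n + u)) :=
    Measure.isProbabilityMeasure_map (by fun_prop)
  rw [trialLaw, Measure.compProd_apply hm']
  have hk : ∀ x, responseKernel θ.β x (Prod.mk x ⁻¹' {p : ℝ × Fin 2 | p.2 = 1}) =
      ENNReal.ofReal (logisticFun (θ.β 0 + θ.β 1 * x)) := fun x => by
    change (ENNReal.ofReal (logisticFun (θ.β 0 + θ.β 1 * x)) • Measure.dirac (1 : Fin 2)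
      + ENNReal.ofReal (1 - logisticFun (θ.β 0 + θ.β 1 * x)) • Measure.dirac (0 : Fin 2)) _ = _
    simp
  have hml := measurable_logisticFun
  simp only [hk]
  rw [lintegral_map (by fun_prop) (by fun_prop), ← integral_logisticFun_gaussianReal,
    ofReal_integral_eq_lintegral_ofReal _ (ae_of_all _ fun u => logisticFun_nonneg _)]
  · refine lintegral_congr fun u => ?_
    congr 2
    ring
  · simpa using integrable_eval_logisticFun (μ := gaussianReal 0 θ.τsq) Polynomial.X
      (θ.β 0 + θ.β 1 * X₀ n) (θ.β 1)

theorem not_scale_lt_of_functionalObsLaw_eq {N : ℕ} {X₀ : Fin N → ℝ}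
    (hX₀ : 4 ≤ (Set.range X₀).ncard) {θ₁ θ₂ : BerksonParam}
    (h : functionalObsLaw X₀ θ₁ = functionalObsLaw X₀ θ₂) :
    ¬ |θ₁.β 1| * √θ₁.τsq < |θ₂.β 1| * √θ₂.τsq := fun hlt => by
  refine (ncard_lt_four_of_logisticMean_eq (a := θ₁.β 0) (b := θ₁.β 1) (a' := θ₂.β 0)
    (b' := θ₂.β 1) (by positivity) hlt ?_ ?_).not_ge hX₀
  -- The larger scale is positive, so its slope cannot vanish.
  · intro h0
    rw [h0, abs_zero, zero_mul] at hlt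
    exact absurd hlt (not_lt.2 (by positivity))
  · rintro _ ⟨n, rfl⟩
    have hn := functionalObsLaw_response X₀ θ₂ n
    rw [← h, functionalObsLaw_response, ENNReal.ofReal_eq_ofReal_iff (logisticMean_pos _ _).le
      (logisticMean_pos _ _).le] at hn
    exact hn

theorem parameters_eq_of_functionalObsLaw_eq {N : ℕ} {X₀ : Fin N → ℝ}
    (hX₀ : 4 ≤ (Set.range X₀).ncard) {θ₁ θ₂ : BerksonParam}
    (h : functionalObsLaw X₀ θ₁ = functionalObsLaw X₀ θ₂) :
    θ₁.β = θ₂.β ∧ θ₁.β 1 ^ 2 * (θ₁.τsq : ℝ) = θ₂.β 1 ^ 2 * (θ₂.τsq : ℝ) := by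
  have hs : |θ₁.β 1| * √θ₁.τsq = |θ₂.β 1| * √θ₂.τsq :=
    le_antisymm (not_lt.1 (not_scale_lt_of_functionalObsLaw_eq hX₀ h.symm))
      (not_lt.1 (not_scale_lt_of_functionalObsLaw_eq hX₀ h))
  have hlin : ∀ n, θ₁.β 0 + θ₁.β 1 * X₀ n = θ₂.β 0 + θ₂.β 1 * X₀ n := fun n => by
    have hn := functionalObsLaw_response X₀ θ₂ n
    rw [← h, functionalObsLaw_response, ENNReal.ofReal_eq_ofReal_iff (logisticMean_pos _ _).le
      (logisticMean_pos _ _).le, hs] at hn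
    exact (strictMono_logisticMean _).injective hn
  obtain ⟨_, _, ⟨i, rfl⟩, ⟨j, rfl⟩, hij⟩ := (Set.one_lt_ncard_iff (Set.finite_range X₀)).1
    (show 1 < (Set.range X₀).ncard by omega)
  have h1 : θ₁.β 1 = θ₂.β 1 := by
    have : (θ₁.β 1 - θ₂.β 1) * (X₀ i - X₀ j) = 0 := by linarith [hlin i, hlin j]
    exact sub_eq_zero.1 ((mul_eq_zero.1 this).resolve_right (sub_ne_zero.2 hij))
  have h0 : θ₁.β 0 = θ₂.β 0 := by
    have := hlin i
    rw [h1] at this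
    linarith
  refine ⟨funext fun k => ?_, ?_⟩
  · fin_cases k
    · exact h0
    · exact h1
  · have := congrArg (· ^ 2) hs
    simpa [mul_pow] using this

theorem mainTheorem2 {N : ℕ} (X₀ : Fin N → ℝ) (hX₀ : 4 ≤ (Set.range X₀).ncard) :
    IsIdentifiable (functionalObsLaw X₀) (fun θ => θ.β) ∧
      IsIdentifiable (functionalObsLaw X₀) (fun θ => θ.β 1 ^ 2 * (θ.τsq : ℝ)) :=
  ⟨fun _ _ h => (parameters_eq_of_functionalObsLaw_eq hX₀ h).1,
    fun _ _ h => (parameters_eq_of_functionalObsLaw_eq hX₀ h).2⟩
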